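/- **Theorem (concentration of centered bilinear functions under external fields).** Let $G=(V,E)$ be a finite simple graph with $|V|=n\ge 2$, and let $p$ be the Ising model on $\{\pm1\}^V$, $$p(x)\ \propto\ \exp\Big(\sum_{v\in V}\theta_v x_v+\sum_{\{u,v\}\in E}\theta_{uv}x_ux_v\Big),$$ with arbitrary real external fields $\theta_v$ and arbitrary real edge parameters $\theta_{uv}$ (put $\theta_{uv}=0$ for $\{u,v\}\notin E$). Suppose that $p$ is in $\eta$-high temperature, i.e. $\eta>0$ and $$\max_{v\in V}\sum_{u\ne v}\tanh|\theta_{uv}|\le 1-\eta .$$ Let $a=(a_{uv})_{u,v\in V}$ be real coefficients with $|a_{uv}|\le 1$ for all $u,v$. 1. There exist absolute constants $c,c'>0$ (not depending on $G,\theta,\eta,a,n,r$) such that, if $X\sim p$ and $f_a(X)=\sum_{u,v\in V}a_{uv}(X_u-\mathbf E[X_u])(X_v-\mathbf E[X_v])$, then for every $r\ge c\,n\log^2 n/\eta$, $$\Pr\big[|f_a(X)-\mathbf E[f_a(X)]|\ge r\big]\le 4\exp\Big(-\frac{\eta r}{c'\,n\log n}\Big).$$ 2. There exist absolute constants $c,c'>0$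 (not depending on $G,\theta,\eta,a,n,r$) such that, if $X^{(1)},X^{(2)}$ are two independent samples from $p$ and $f_a(X^{(1)},X^{(2)})=\sum_{u,v\in V}a_{uv}(X^{(1)}_u-X^{(2)}_u)(X^{(1)}_v-X^{(2)}_v)$, then for every $r\ge c\,n\log^2 n/\eta$, $$\Pr\big[|f_a(X^{(1)},X^{(2)})-\mathbf E[f_a(X^{(1)},X^{(2)})]|\ge r\big]\le 4\exp\Big(-\frac{\eta r}{c'\,n\log n}\Big).$$ -/

import Mathlib

open MeasureTheory ProbabilityTheory
open scoped ENNReal BigOperators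

/-- Spins are elements of `{-1, 1}`, here the units of `ℤ`; singletons are measurable. -/
instance instMeasurableSingletonClassIntUnits : MeasurableSingletonClass ℤˣ where
  measurableSet_singleton x := by
    refine ⟨{(x : ℤ)}, MeasurableSet.singleton _, ?_⟩
    ext y
    simp [Units.ext_iff]

/-- The parameters of an Ising model on a graph with vertex set `V`: an external field `θ_v` on
every vertex and an interaction `θ_{uv}` on every edge, extended by zero to the pairs that are not
edges. -/
structure IsingModel (V : Type*) where
  /-- The underlying (simple) graph. -/
  graph : SimpleGraph V
  /-- The external field `θ_v`. -/
  field : V → ℝ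
  /-- The edge parameter `θ_{uv}`. -/
  coupling : V → V → ℝ
  coupling_symm : ∀ u v, coupling u v = coupling v u
  coupling_eq_zero : ∀ u v, ¬ graph.Adj u v → coupling u v = 0

namespace IsingModel

variable {V : Type*} [Fintype V] [DecidableEq V]

/-- The real value `x_v ∈ {-1, 1}` of the spin at `v`. -/
def spin (x : V → ℤˣ) (v : V) : ℝ := ((x v : ℤ) : ℝ)

/-- `∑_v θ_v x_v + ∑_{{u,v} ∈ E} θ_{uv} x_u x_v`. The double sum visits each edge twice, hence the
factor `1/2`. -/
noncomputable def energy (p : IsingModel V) (x : V → ℤˣ) : ℝ :=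
  ∑ v, p.field v * spin x v + (1 / 2) * ∑ u, ∑ v, p.coupling u v * spin x u * spin x v

/-- The normalizing constant. -/
noncomputable def partitionFunction (p : IsingModel V) : ℝ :=
  ∑ x : V → ℤˣ, Real.exp (p.energy x)

theorem partitionFunction_pos (p : IsingModel V) : 0 < p.partitionFunction :=
  Finset.sum_pos (fun _ _ => Real.exp_pos _) Finset.univ_nonempty

/-- The probability mass function of the Ising model on `{-1, 1}^V`,
proportional to `exp (energy x)`. -/
noncomputable def pmf (p : IsingModel V) : PMF (V → ℤˣ) :=
  PMF.ofFintype (fun x => ENNReal.ofReal (Real.exp (p.energy x) / p.partitionFunction)) (by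
    rw [← ENNReal.ofReal_sum_of_nonneg
      (fun x _ => div_nonneg (Real.exp_pos _).le p.partitionFunction_pos.le),
      ← Finset.sum_div]
    change ENNReal.ofReal (p.partitionFunction / p.partitionFunction) = 1
    rw [div_self p.partitionFunction_pos.ne', ENNReal.ofReal_one])

/-- The Ising model as a probability measure on `{-1, 1}^V`. -/
noncomputable def law (p : IsingModel V) : Measure (V → ℤˣ) := p.pmf.toMeasure

/-- `η`-high temperature (Dobrushin's uniqueness condition):
`max_v ∑_{u ≠ v} tanh |θ_{uv}| ≤ 1 - η` with `η > 0`. -/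
def IsHighTemperature (p : IsingModel V) (η : ℝ) : Prop :=
  0 < η ∧ ∀ v, ∑ u ∈ Finset.univ.erase v, Real.tanh |p.coupling u v| ≤ 1 - η

/-- `f_a(X) = ∑_{u,v} a_{uv} (X_u - E X_u) (X_v - E X_v)` for a random configuration `X`. -/
noncomputable def centeredBilinear {Ω : Type*} [MeasurableSpace Ω] (P : Measure Ω)
    (a : V → V → ℝ) (X : Ω → V → ℤˣ) (ω : Ω) : ℝ :=
  ∑ u, ∑ v, a u v * (spin (X ω) u - ∫ ω', spin (X ω') u ∂P) *
    (spin (X ω) v - ∫ ω', spin (X ω') v ∂P)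

/-- `f_a(x, y) = ∑_{u,v} a_{uv} (x_u - y_u) (x_v - y_v)`. -/
noncomputable def differenceBilinear (a : V → V → ℝ) (x y : V → ℤˣ) : ℝ :=
  ∑ u, ∑ v, a u v * (spin x u - spin y u) * (spin x v - spin y v)

end IsingModel

/-!
# Concentration of bilinear functions of high-temperature Ising models

Tilting the Ising measure by `exp (s * f)`, where `f = ∑ a_{uv} (x_u - m_u) (x_v - m_v)` is a
quadratic form centred at the mean `m`, gives again an Ising model, with couplings `J + 2 s a`. For
`|s| ≤ O(η / n)` its Dobrushin sums still leave a gap of at least `η / 2`. The second derivative of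
the cumulant generating function of `f` at `s` is the variance of `f` in the tilted model, so a
bound `O(n² / η²)` on these variances bounds `E exp (s (f - E f))` by a constant for `s` of order
`η / n`, and Markov's inequality gives tails `4 exp (-c η r / n)` for every `r`. This is stronger
than required: the factor `log n` in the exponent and the threshold on `r` are not needed.

The variances are bounded by the Poincaré inequality `mul_gibbsVar_le`. Under Dobrushin's condition
Glauber dynamics contracts the maximal oscillation of a function by `1 - η / n`, and reversibility
turns this into the same contraction in `L²`. The discrete gradient of a quadratic form is linear,
so a second use of the inequality for linear functions gives `O(n² / η²)` when the form is centred
at the mean of the model. In the tilted model the mean has moved away from `m`; the drift is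
controlled by Cauchy–Schwarz through the very variance that is to be bounded, with a factor small
enough to be absorbed (`Dobrushin.gibbsExp_exp_quadForm_le`).

Two independent samples form a single Ising model on the disjoint union `V ⊕ V`, at the same
temperature, and the bilinear function of the difference is a centred bilinear function of it since
the means cancel. So the second bound is the first one on `2 n` vertices.
-/

namespace IsingModel

/-! ### Gibbs expectations on a finite set and their exponential tilts -/

section Gibbs

variable {S : Type*} [Fintype S]

/-- The expectation of `f` under the Gibbs measure with density proportional to `exp H` on a finite
set. -/
noncomputable def gibbsExp (H f : S → ℝ) : ℝ :=
  (∑ x, Real.exp (H x) * f x) / ∑ x, Real.exp (H x)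

/-- The variance of `f` under the Gibbs measure with density proportional to `exp H`. -/
noncomputable def gibbsVar (H f : S → ℝ) : ℝ :=
  gibbsExp H fun x => (f x - gibbsExp H f) ^ 2

variable (H : S → ℝ)

theorem gibbsExp_add (f g : S → ℝ) :
    gibbsExp H (fun x => f x + g x) = gibbsExp H f + gibbsExp H g := by
  simp only [gibbsExp, mul_add, Finset.sum_add_distrib, add_div]

theorem gibbsExp_sub (f g : S → ℝ) :
    gibbsExp H (fun x => f x - g x) = gibbsExp H f - gibbsExp H g := by
  simp only [gibbsExp, mul_sub, Finset.sum_sub_distrib, sub_div]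

theorem gibbsExp_const_mul (c : ℝ) (f : S → ℝ) :
    gibbsExp H (fun x => c * f x) = c * gibbsExp H f := by
  simp only [gibbsExp, ← mul_div_assoc, Finset.mul_sum, mul_left_comm]

theorem gibbsExp_sum {ι : Type*} (s : Finset ι) (f : ι → S → ℝ) :
    gibbsExp H (fun x => ∑ i ∈ s, f i x) = ∑ i ∈ s, gibbsExp H (f i) := by
  simp only [gibbsExp, Finset.mul_sum, ← Finset.sum_div]
  rw [Finset.sum_comm]

theorem gibbsExp_mono {f g : S → ℝ} (h : ∀ x, f x ≤ g x) : gibbsExp H f ≤ gibbsExp H g := by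
  unfold gibbsExp
  gcongr
  exact h _

theorem gibbsExp_nonneg {f : S → ℝ} (h : ∀ x, 0 ≤ f x) : 0 ≤ gibbsExp H f :=
  div_nonneg (Finset.sum_nonneg fun x _ => mul_nonneg (Real.exp_pos _).le (h x))
    (Finset.sum_nonneg fun _ _ => (Real.exp_pos _).le)

theorem gibbsExp_mul_sq_le (f g : S → ℝ) :
    gibbsExp H (fun x => f x * g x) ^ 2 ≤
      gibbsExp H (fun x => f x ^ 2) * gibbsExp H (fun x => g x ^ 2) := by
  unfold gibbsExp
  rw [div_pow, div_mul_div_comm, ← sq]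
  gcongr
  have h := Finset.sum_mul_sq_le_sq_mul_sq Finset.univ
    (fun x => Real.exp (H x / 2) * f x) (fun x => Real.exp (H x / 2) * g x)
  have e : ∀ x, Real.exp (H x) = Real.exp (H x / 2) * Real.exp (H x / 2) := fun _ => by
    rw [← Real.exp_add]; ring_nf
  convert h using 2
  · congr 1; ext x; rw [e]; ring
  · congr 1; ext x; rw [e]; ring
  · congr 1; ext x; rw [e]; ring

theorem gibbsVar_nonneg (f : S → ℝ) : 0 ≤ gibbsVar H f :=
  gibbsExp_nonneg H fun _ => sq_nonneg _

/-- Adding a constant to the energy does not change the Gibbs measure. -/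
theorem gibbsExp_add_const (c : ℝ) (f : S → ℝ) :
    gibbsExp (fun x => H x + c) f = gibbsExp H f := by
  simp only [gibbsExp, Real.exp_add, mul_right_comm _ (Real.exp c), ← Finset.sum_mul]
  exact mul_div_mul_right _ _ (Real.exp_pos c).ne'

theorem gibbsVar_add_const (c : ℝ) (f : S → ℝ) :
    gibbsVar (fun x => H x + c) f = gibbsVar H f := by
  simp only [gibbsVar, gibbsExp_add_const]

theorem hasDerivAt_sum_exp_mul (f g : S → ℝ) (s : ℝ) :
    HasDerivAt (fun s => ∑ x, Real.exp (H x + s * f x) * g x)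
      (∑ x, Real.exp (H x + s * f x) * (g x * f x)) s := by
  apply HasDerivAt.fun_sum
  intro x _
  have h1 : HasDerivAt (fun s : ℝ => H x + s * f x) (f x) s := by
    simpa using ((hasDerivAt_id s).mul_const (f x)).const_add (H x)
  exact (h1.exp.mul_const (g x)).congr_deriv (by ring)

variable [Nonempty S]

theorem sum_exp_pos : 0 < ∑ x, Real.exp (H x) :=
  Finset.sum_pos (fun _ _ => Real.exp_pos _) Finset.univ_nonempty

@[simp]
theorem gibbsExp_const (c : ℝ) : gibbsExp H (fun _ => c) = c := by
  rw [gibbsExp, ← Finset.sum_mul, mul_div_assoc, mul_comm, div_mul_cancel₀ _ (sum_exp_pos H).ne']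

theorem gibbsExp_mul_sub_mean (f g : S → ℝ) :
    gibbsExp H (fun x => (f x - gibbsExp H f) * (g x - gibbsExp H g)) =
      gibbsExp H (fun x => f x * g x) - gibbsExp H f * gibbsExp H g := by
  have e : ∀ x, (f x - gibbsExp H f) * (g x - gibbsExp H g) =
      f x * g x - gibbsExp H f * g x - gibbsExp H g * f x + gibbsExp H f * gibbsExp H g :=
    fun x => by ring
  simp only [e, gibbsExp_add, gibbsExp_sub, gibbsExp_const_mul, gibbsExp_const]
  ring

theorem gibbsVar_eq (f : S → ℝ) :
    gibbsVar H f = gibbsExp H (fun x => f x ^ 2) - gibbsExp H f ^ 2 := by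
  simpa only [gibbsVar, sq] using gibbsExp_mul_sub_mean H f f

/-- The second moment about a point, as variance plus squared bias. -/
theorem gibbsExp_sub_sq (f : S → ℝ) (c : ℝ) :
    gibbsExp H (fun x => (f x - c) ^ 2) = gibbsVar H f + (gibbsExp H f - c) ^ 2 := by
  have e : ∀ x, (f x - c) ^ 2 = f x ^ 2 - (2 * c) * f x + c ^ 2 := fun x => by ring
  simp only [e, gibbsVar_eq, gibbsExp_add, gibbsExp_sub, gibbsExp_const_mul, gibbsExp_const]
  ring

/-- Along the exponential tilt by `f`, the expectation of `g` moves at the rate of its covariance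
with `f`. -/
theorem hasDerivAt_gibbsExp (f g : S → ℝ) (s : ℝ) :
    HasDerivAt (fun s => gibbsExp (fun x => H x + s * f x) g)
      (gibbsExp (fun x => H x + s * f x) (fun x => g x * f x) -
        gibbsExp (fun x => H x + s * f x) g * gibbsExp (fun x => H x + s * f x) f) s := by
  have hZ := sum_exp_pos (fun x => H x + s * f x)
  have h1 := hasDerivAt_sum_exp_mul H f (fun _ => 1) s
  simp only [mul_one, one_mul] at h1
  refine ((hasDerivAt_sum_exp_mul H f g s).div h1 hZ.ne').congr_deriv ?_
  simp only [gibbsExp]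
  field_simp

theorem continuous_gibbsVar_tilt (f : S → ℝ) :
    Continuous fun s : ℝ => gibbsVar (fun x => H x + s * f x) f := by
  have h : ∀ g : S → ℝ, Continuous fun s : ℝ => gibbsExp (fun x => H x + s * f x) g := fun g =>
    continuous_iff_continuousAt.2 fun s => (hasDerivAt_gibbsExp H f g s).continuousAt
  simp only [gibbsVar_eq]
  exact (h _).sub ((h _).pow 2)

/-- By Cauchy–Schwarz, the expectation of `g` moves at most at speed `√(W * V)` along the tilt by
`f` if `V` and `W` bound the variances of `f` and `g` along it. -/
theorem gibbsExp_tilt_sub_le (f g : S → ℝ) {T V W : ℝ} (hT : 0 ≤ T)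
    (hV : ∀ s ∈ Set.Icc 0 T, gibbsVar (fun x => H x + s * f x) f ≤ V)
    (hW : ∀ s ∈ Set.Icc 0 T, gibbsVar (fun x => H x + s * f x) g ≤ W) :
    gibbsExp (fun x => H x + T * f x) g - gibbsExp H g ≤ Real.sqrt (W * V) * T := by
  have key : ∀ s ∈ interior (Set.Icc 0 T),
      deriv (fun s => gibbsExp (fun x => H x + s * f x) g) s ≤ Real.sqrt (W * V) := by
    intro s hs
    have hs := interior_subset hs
    rw [(hasDerivAt_gibbsExp H f g s).deriv, ← gibbsExp_mul_sub_mean]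
    refine Real.le_sqrt_of_sq_le ((gibbsExp_mul_sq_le _ _ _).trans ?_)
    exact mul_le_mul (hW s hs) (hV s hs) (gibbsVar_nonneg _ f)
      ((gibbsVar_nonneg _ g).trans (hW s hs))
  have hd : Differentiable ℝ fun s : ℝ => gibbsExp (fun x => H x + s * f x) g := fun s =>
    (hasDerivAt_gibbsExp H f g s).differentiableAt
  have := (convex_Icc 0 T).image_sub_le_mul_sub_of_deriv_le hd.continuous.continuousOn
    hd.differentiableOn key 0 ⟨le_rfl, hT⟩ T ⟨hT, le_rfl⟩ hT
  simpa using this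

/-- A bound on the variance of `f` along the exponential tilt by `f` bounds the centred moment
generating function, since the second derivative of the cumulant generating function is that
variance. -/
theorem gibbsExp_exp_le (f : S → ℝ) {T V : ℝ} (hT : 0 ≤ T)
    (hV : ∀ s ∈ Set.Icc 0 T, gibbsVar (fun x => H x + s * f x) f ≤ V) :
    gibbsExp H (fun x => Real.exp (T * (f x - gibbsExp H f))) ≤ Real.exp (V * T ^ 2) := by
  have hV0 : 0 ≤ V := (gibbsVar_nonneg _ f).trans (hV 0 ⟨le_rfl, hT⟩)
  have hZ : ∀ s : ℝ, 0 < ∑ x, Real.exp (H x + s * f x) := fun s => sum_exp_pos _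
  have hder : ∀ s : ℝ, HasDerivAt (fun s => Real.log (∑ x, Real.exp (H x + s * f x)))
      (gibbsExp (fun x => H x + s * f x) f) s := by
    intro s
    have h1 := hasDerivAt_sum_exp_mul H f (fun _ => 1) s
    simp only [mul_one, one_mul] at h1
    exact h1.log (hZ s).ne'
  have hd : Differentiable ℝ fun s : ℝ => Real.log (∑ x, Real.exp (H x + s * f x)) := fun s =>
    (hder s).differentiableAt
  have key : ∀ s ∈ interior (Set.Icc 0 T),
      deriv (fun s => Real.log (∑ x, Real.exp (H x + s * f x))) s ≤ gibbsExp H f + V * T := by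
    intro s hs
    obtain ⟨h0, h1⟩ := interior_subset hs
    rw [(hder s).deriv]
    have := gibbsExp_tilt_sub_le H f f h0 (fun t ht => hV t ⟨ht.1, ht.2.trans h1⟩)
      (fun t ht => hV t ⟨ht.1, ht.2.trans h1⟩)
    rw [Real.sqrt_mul_self hV0] at this
    nlinarith [mul_le_mul_of_nonneg_left h1 hV0]
  have := (convex_Icc 0 T).image_sub_le_mul_sub_of_deriv_le hd.continuous.continuousOn
    hd.differentiableOn key 0 ⟨le_rfl, hT⟩ T ⟨hT, le_rfl⟩ hT
  simp only [zero_mul, add_zero, sub_zero] at this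
  have hZ0 : 0 < ∑ x, Real.exp (H x) := sum_exp_pos H
  rw [← Real.log_div (hZ T).ne' hZ0.ne', Real.log_le_iff_le_exp (div_pos (hZ T) hZ0)] at this
  have e : gibbsExp H (fun x => Real.exp (T * (f x - gibbsExp H f))) =
      Real.exp (-(T * gibbsExp H f)) *
        ((∑ x, Real.exp (H x + T * f x)) / ∑ x, Real.exp (H x)) := by
    rw [gibbsExp, ← mul_div_assoc, Finset.mul_sum]
    congr 1
    refine Finset.sum_congr rfl fun x _ => ?_
    rw [← Real.exp_add, ← Real.exp_add]
    ring_nf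
  rw [e]
  calc _ ≤ Real.exp (-(T * gibbsExp H f)) * Real.exp ((gibbsExp H f + V * T) * T) := by gcongr
    _ = _ := by rw [← Real.exp_add]; ring_nf

end Gibbs

/-! ### A Poincaré inequality from the contraction of Glauber dynamics -/

section Poincare

/-- A nonnegative log-convex sequence that decays at the geometric rate `r` already does so in its
first step. -/
theorem log_convex_first_step_le {b : ℕ → ℝ} {C r : ℝ} (hb : ∀ k, 0 ≤ b k)
    (hconv : ∀ k, b (k + 1) ^ 2 ≤ b k * b (k + 2)) (hr : 0 ≤ r) (hC : ∀ k, b k ≤ C * r ^ k) :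
    b 1 ≤ r * b 0 := by
  rcases (hb 0).eq_or_lt with h0 | h0
  · have := hconv 0
    rw [← h0, zero_mul] at this
    have : b 1 = 0 := pow_eq_zero_iff two_ne_zero |>.1 (le_antisymm this (sq_nonneg _))
    rw [this, ← h0, mul_zero]
  by_contra! hlt
  set q := b 1 / b 0 with hq
  have hrq : r < q := (lt_div_iff₀ h0).2 hlt
  have hq0 : 0 < q := hr.trans_lt hrq
  have step : ∀ k, 0 < b k ∧ q * b k ≤ b (k + 1) := by
    intro k
    induction k with
    | zero => exact ⟨h0, by rw [hq, div_mul_cancel₀ _ h0.ne']⟩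
    | succ k ih =>
      obtain ⟨hk, hk'⟩ := ih
      have hpos : 0 < b (k + 1) := (mul_pos hq0 hk).trans_le hk'
      refine ⟨hpos, le_of_mul_le_mul_left ?_ hk⟩
      nlinarith [hconv k]
  have low : ∀ k, b 0 * q ^ k ≤ b k := by
    intro k
    induction k with
    | zero => simp
    | succ k ih =>
      calc b 0 * q ^ (k + 1) = q * (b 0 * q ^ k) := by ring
        _ ≤ q * b k := by gcongr
        _ ≤ _ := (step k).2
  have hC0 : 0 < C := by simpa using h0.trans_le (hC 0)
  have hrq1 : r / q < 1 := (div_lt_one hq0).2 hrq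
  obtain ⟨k, hk⟩ := exists_pow_lt_of_lt_one (div_pos h0 hC0) hrq1
  rw [div_pow, div_lt_div_iff₀ (pow_pos hq0 k) hC0] at hk
  linarith [low k, hC k]

variable {V : Type*} [DecidableEq V]

/-- The configuration `x` with the spin at `v` reversed. -/
def flip (v : V) (x : V → ℤˣ) : V → ℤˣ := Function.update x v (-x v)

@[simp]
theorem flip_flip (v : V) (x : V → ℤˣ) : flip v (flip v x) = x := by
  simp [flip]

theorem flip_comm (u v : V) (x : V → ℤˣ) : flip u (flip v x) = flip v (flip u x) := by
  rcases eq_or_ne u v with rfl | h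
  · rfl
  · simp [flip, Function.update_of_ne h, Function.update_of_ne h.symm, Function.update_comm h]

/-- The probability that a heat-bath update at `v` reverses the spin there. -/
noncomputable def flipProb (H : (V → ℤˣ) → ℝ) (v : V) (x : V → ℤˣ) : ℝ :=
  Real.exp (H (flip v x)) / (Real.exp (H x) + Real.exp (H (flip v x)))

variable (H : (V → ℤˣ) → ℝ)

theorem flipProb_nonneg (v : V) (x : V → ℤˣ) : 0 ≤ flipProb H v x := by
  unfold flipProb; positivity

theorem flipProb_le_one (v : V) (x : V → ℤˣ) : flipProb H v x ≤ 1 :=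
  (div_le_one (by positivity)).2 (by linarith [Real.exp_pos (H x)])

theorem flipProb_flip (v : V) (x : V → ℤˣ) : flipProb H v (flip v x) = 1 - flipProb H v x := by
  unfold flipProb
  rw [flip_flip, eq_sub_iff_add_eq, add_comm (Real.exp (H (flip v x))), ← add_div]
  exact div_self (by positivity)

/-- Detailed balance. -/
theorem exp_mul_flipProb_flip (v : V) (x : V → ℤˣ) :
    Real.exp (H (flip v x)) * flipProb H v (flip v x) = Real.exp (H x) * flipProb H v x := by
  unfold flipProb
  rw [flip_flip, add_comm (Real.exp (H (flip v x)))]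
  ring

/-- Heat-bath update at the single site `v`: the conditional expectation of `f` given the spins
away from `v`. -/
noncomputable def heatBath (v : V) (f : (V → ℤˣ) → ℝ) (x : V → ℤˣ) : ℝ :=
  f x + flipProb H v x * (f (flip v x) - f x)

/-- A site update removes the dependence on the updated spin and passes at most `c * D` of it on to
another site, where `c` bounds the influence between the sites. -/
theorem abs_heatBath_sub_flip_le {f : (V → ℤˣ) → ℝ} {D c : ℝ} (v w : V)
    (hf : ∀ v x, |f x - f (flip v x)| ≤ D)
    (hc : ∀ x, |flipProb H w x - flipProb H w (flip v x)| ≤ c) (x : V → ℤˣ) :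
    |heatBath H w f x - heatBath H w f (flip v x)| ≤ D + c * D := by
  have hD : 0 ≤ D := (abs_nonneg _).trans (hf v x)
  set q := flipProb H w x with hq
  have hq0 : 0 ≤ q := flipProb_nonneg H w x
  have hq1 : q ≤ 1 := flipProb_le_one H w x
  have e : heatBath H w f x - heatBath H w f (flip v x) =
      (1 - q) * (f x - f (flip v x)) + q * (f (flip w x) - f (flip v (flip w x))) +
        (q - flipProb H w (flip v x)) * (f (flip w (flip v x)) - f (flip v x)) := by
    simp only [heatBath, ← hq, flip_comm v w]
    ring
  rw [e]
  calc _ ≤ |(1 - q) * (f x - f (flip v x))| + |q * (f (flip w x) - f (flip v (flip w x)))| +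
        |(q - flipProb H w (flip v x)) * (f (flip w (flip v x)) - f (flip v x))| :=
        abs_add_three _ _ _
    _ ≤ (1 - q) * D + q * D + c * D := by
        rw [abs_mul, abs_mul, abs_mul, abs_of_nonneg hq0, abs_of_nonneg (sub_nonneg.2 hq1),
          abs_sub_comm (f (flip w (flip v x)))]
        have := sub_nonneg.2 hq1
        gcongr
        · exact hf _ _
        · exact hf _ _
        · exact (abs_nonneg _).trans (hc x)
        · exact hc x
        · exact hf _ _
    _ = _ := by ring

theorem heatBath_flip_self (v : V) (f : (V → ℤˣ) → ℝ) (x : V → ℤˣ) :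
    heatBath H v f (flip v x) = heatBath H v f x := by
  simp only [heatBath, flipProb_flip, flip_flip]
  ring

variable [Fintype V]

/-- One step of Glauber dynamics: a heat-bath update at a uniformly random site. -/
noncomputable def glauber (f : (V → ℤˣ) → ℝ) (x : V → ℤˣ) : ℝ :=
  (∑ w, heatBath H w f x) / Fintype.card V

omit [DecidableEq V] in
theorem card_pos_real [Nonempty V] : (0 : ℝ) < Fintype.card V := by
  exact_mod_cast Fintype.card_pos

/-- Under Dobrushin's condition, Glauber dynamics contracts the maximal oscillation. -/
theorem abs_glauber_sub_flip_le [Nonempty V] {c : V → V → ℝ} {η D : ℝ} {f : (V → ℤˣ) → ℝ}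
    (hc : ∀ v w, v ≠ w → ∀ x, |flipProb H w x - flipProb H w (flip v x)| ≤ c v w)
    (hη : ∀ v, ∑ w ∈ Finset.univ.erase v, c v w ≤ 1 - η)
    (hf : ∀ v x, |f x - f (flip v x)| ≤ D) (v : V) (x : V → ℤˣ) :
    |glauber H f x - glauber H f (flip v x)| ≤ (1 - η / Fintype.card V) * D := by
  have hD : 0 ≤ D := (abs_nonneg _).trans (hf v x)
  have hn : (0 : ℝ) < Fintype.card V := card_pos_real
  rw [glauber, glauber, ← sub_div, abs_div, abs_of_pos hn, div_le_iff₀ hn,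
    ← Finset.sum_sub_distrib, ← Finset.add_sum_erase _ _ (Finset.mem_univ v), heatBath_flip_self,
    sub_self, zero_add]
  calc _ ≤ ∑ w ∈ Finset.univ.erase v, |heatBath H w f x - heatBath H w f (flip v x)| :=
        Finset.abs_sum_le_sum_abs _ _
    _ ≤ ∑ w ∈ Finset.univ.erase v, (D + c v w * D) := Finset.sum_le_sum fun w hw =>
        abs_heatBath_sub_flip_le H v w hf
          (hc v w (Finset.ne_of_mem_erase hw).symm) x
    _ = (Fintype.card V - 1) * D + (∑ w ∈ Finset.univ.erase v, c v w) * D := by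
        rw [Finset.sum_add_distrib, Finset.sum_const, ← Finset.sum_mul, nsmul_eq_mul,
          Finset.card_erase_of_mem (Finset.mem_univ v), Finset.card_univ,
          Nat.cast_pred Fintype.card_pos]
    _ ≤ (Fintype.card V - 1) * D + (1 - η) * D := by gcongr; exact hη v
    _ = _ := by field_simp; ring

omit H in
theorem abs_sub_le_card_mul {D : ℝ} {f : (V → ℤˣ) → ℝ}
    (hf : ∀ v x, |f x - f (flip v x)| ≤ D) (x y : V → ℤˣ) :
    |f x - f y| ≤ Fintype.card V * D := by
  suffices h : ∀ s : Finset V, ∀ x, (∀ v ∉ s, x v = y v) → |f x - f y| ≤ s.card * D from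
    h Finset.univ x fun v hv => absurd (Finset.mem_univ v) hv
  intro s
  induction s using Finset.induction_on with
  | empty =>
    intro x hx
    have : x = y := funext fun v => hx v (Finset.notMem_empty v)
    simp [this]
  | insert v s hv ih =>
    intro x hx
    have hD : 0 ≤ D := (abs_nonneg _).trans (hf v x)
    rw [Finset.card_insert_of_notMem hv, Nat.cast_add_one, add_mul, one_mul]
    by_cases hxy : x v = y v
    · refine (ih x fun w hw => ?_).trans (by linarith)
      rcases eq_or_ne w v with rfl | hwv
      · exact hxy
      · exact hx w (by simp [hwv, hw])
    · have h1 := ih (flip v x) fun w hw => by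
        rcases eq_or_ne w v with rfl | hwv
        · rcases Int.units_eq_one_or (x w) with h | h <;>
            rcases Int.units_eq_one_or (y w) with h' | h' <;> simp_all [flip]
        · rw [flip, Function.update_of_ne hwv]
          exact hx w (by simp [hwv, hw])
      calc |f x - f y| ≤ |f x - f (flip v x)| + |f (flip v x) - f y| := abs_sub_le _ _ _
        _ ≤ D + s.card * D := add_le_add (hf v x) h1
        _ = _ := by ring

/-- Integration by parts for a single-site update. -/
theorem gibbsExp_mul_sub_heatBath (v : V) (f g : (V → ℤˣ) → ℝ) :
    gibbsExp H (fun x => g x * (f x - heatBath H v f x)) =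
      gibbsExp H fun x => (1 / 2) * flipProb H v x *
        ((g x - g (flip v x)) * (f x - f (flip v x))) := by
  unfold gibbsExp
  congr 1
  have flip_sum : ∀ F : (V → ℤˣ) → ℝ, ∑ x, F (flip v x) = ∑ x, F x := fun F =>
    Equiv.sum_comp (Function.Involutive.toPerm (flip v) (flip_flip v)) F
  set A : (V → ℤˣ) → ℝ := fun x =>
    Real.exp (H x) * flipProb H v x * (g x * (f x - f (flip v x))) with hA
  have hA' : ∀ x, A (flip v x) =
      Real.exp (H x) * flipProb H v x * (g (flip v x) * (f (flip v x) - f x)) := fun x => by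
    simp only [hA, exp_mul_flipProb_flip, flip_flip]
  calc _ = ∑ x, A x := Finset.sum_congr rfl fun x _ => by simp only [hA, heatBath]; ring
    _ = ∑ x, (1 / 2) * (A x + A (flip v x)) := by
        rw [← Finset.mul_sum, Finset.sum_add_distrib, flip_sum]; ring
    _ = _ := Finset.sum_congr rfl fun x _ => by rw [hA']; simp only [hA]; ring

theorem gibbsExp_mul_sub_glauber [Nonempty V] (f g : (V → ℤˣ) → ℝ) :
    Fintype.card V * (gibbsExp H (fun x => g x * f x) - gibbsExp H fun x => g x * glauber H f x) =
      ∑ v, gibbsExp H fun x => (1 / 2) * flipProb H v x *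
        ((g x - g (flip v x)) * (f x - f (flip v x))) := by
  have hn : (Fintype.card V : ℝ) ≠ 0 := card_pos_real.ne'
  rw [← gibbsExp_sub, ← gibbsExp_const_mul]
  simp only [← gibbsExp_mul_sub_heatBath]
  rw [← gibbsExp_sum]
  congr 1
  ext x
  rw [← Finset.mul_sum, Finset.sum_sub_distrib, Finset.sum_const, Finset.card_univ, nsmul_eq_mul,
    glauber]
  field_simp

/-- Glauber dynamics is reversible. -/
theorem gibbsExp_mul_glauber_comm [Nonempty V] (f g : (V → ℤˣ) → ℝ) :
    gibbsExp H (fun x => g x * glauber H f x) = gibbsExp H fun x => glauber H g x * f x := by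
  have hn : (Fintype.card V : ℝ) ≠ 0 := card_pos_real.ne'
  have h1 := gibbsExp_mul_sub_glauber H f g
  have h2 := gibbsExp_mul_sub_glauber H g f
  have e1 : (fun x => f x * g x) = fun x => g x * f x := funext fun x => mul_comm _ _
  have e2 : (fun x => f x * glauber H g x) = fun x => glauber H g x * f x :=
    funext fun x => mul_comm _ _
  have e3 : ∀ v x, (f x - f (flip v x)) * (g x - g (flip v x)) =
    (g x - g (flip v x)) * (f x - f (flip v x)) := fun v x => mul_comm _ _
  rw [e1, e2] at h2
  simp only [e3] at h2
  have := mul_left_cancel₀ hn (h1.trans h2.symm)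
  linarith

theorem gibbsExp_glauber [Nonempty V] (f : (V → ℤˣ) → ℝ) :
    gibbsExp H (glauber H f) = gibbsExp H f := by
  have hn : (Fintype.card V : ℝ) ≠ 0 := card_pos_real.ne'
  have h := gibbsExp_mul_sub_glauber H f fun _ => 1
  simp only [one_mul, sub_self, zero_mul, mul_zero, gibbsExp_const, Finset.sum_const_zero] at h
  have := (mul_eq_zero.1 h).resolve_left hn
  linarith

/-- Glauber dynamics contracts centred functions in `L²` at the same rate at which it contracts
oscillations: the norms of the iterates form a log-convex sequence, by reversibility. -/
theorem gibbsExp_glauber_sq_le [Nonempty V] {c : V → V → ℝ} {η : ℝ} (hη1 : η ≤ 1)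
    (hc : ∀ v w, v ≠ w → ∀ x, |flipProb H w x - flipProb H w (flip v x)| ≤ c v w)
    (hη : ∀ v, ∑ w ∈ Finset.univ.erase v, c v w ≤ 1 - η)
    {f : (V → ℤˣ) → ℝ} (hf : gibbsExp H f = 0) :
    gibbsExp H (fun x => glauber H f x ^ 2) ≤
      ((1 - η / Fintype.card V) ^ 2) * gibbsExp H (fun x => f x ^ 2) := by
  set ρ : ℝ := 1 - η / Fintype.card V with hρ
  have hn : (0 : ℝ) < Fintype.card V := card_pos_real
  have hn1 : (1 : ℝ) ≤ Fintype.card V := by exact_mod_cast (Fintype.card_pos : 0 < Fintype.card V)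
  have hρ0 : 0 ≤ ρ := by
    rw [hρ, sub_nonneg, div_le_one hn]; linarith
  set g : ℕ → (V → ℤˣ) → ℝ := fun k => (glauber H)^[k] f with hg
  have hgs : ∀ k, g (k + 1) = glauber H (g k) := fun k => Function.iterate_succ_apply' _ _ _
  -- a crude oscillation bound for `f`
  set D : ℝ := 2 * ∑ x, |f x| with hDdef
  have hD : ∀ v x, |f x - f (flip v x)| ≤ D := by
    intro v x
    have h : ∀ y, |f y| ≤ ∑ x, |f x| := fun y =>
      Finset.single_le_sum (f := fun x => |f x|) (fun _ _ => abs_nonneg _) (Finset.mem_univ y)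
    calc _ ≤ |f x| + |f (flip v x)| := abs_sub _ _
      _ ≤ D := by linarith [h x, h (flip v x)]
  have hosc : ∀ k v x, |g k x - g k (flip v x)| ≤ ρ ^ k * D := by
    intro k
    induction k with
    | zero => simpa [hg] using hD
    | succ k ih =>
      intro v x
      rw [hgs, pow_succ', mul_assoc]
      exact abs_glauber_sub_flip_le H hc hη ih v x
  have hmean : ∀ k, gibbsExp H (g k) = 0 := by
    intro k
    induction k with
    | zero => exact hf
    | succ k ih => rw [hgs, gibbsExp_glauber, ih]
  have hsup : ∀ k x, |g k x| ≤ Fintype.card V * (ρ ^ k * D) := by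
    intro k x
    have e : ∀ y, g k x - g k y ≤ Fintype.card V * (ρ ^ k * D) ∧
        -(Fintype.card V * (ρ ^ k * D)) ≤ g k x - g k y := fun y =>
      ⟨(le_abs_self _).trans (abs_sub_le_card_mul (hosc k) x y),
        neg_le_of_abs_le (abs_sub_le_card_mul (hosc k) x y)⟩
    have e0 : gibbsExp H (fun y => g k x - g k y) = g k x := by
      rw [gibbsExp_sub, gibbsExp_const, hmean, sub_zero]
    rw [abs_le]
    constructor
    · have := gibbsExp_mono H fun y => (e y).2
      rwa [e0, gibbsExp_const] at this
    · have := gibbsExp_mono H fun y => (e y).1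
      rwa [e0, gibbsExp_const] at this
  refine log_convex_first_step_le (b := fun k => gibbsExp H fun x => g k x ^ 2)
    (C := (Fintype.card V * D) ^ 2) (fun k => gibbsExp_nonneg H fun x => sq_nonneg _)
    (fun k => ?_) (sq_nonneg ρ) fun k => ?_
  · have e : gibbsExp H (fun x => g (k + 1) x ^ 2) = gibbsExp H fun x => g k x * g (k + 2) x := by
      rw [hgs (k + 1), gibbsExp_mul_glauber_comm, ← hgs]
      simp only [sq]
    simp only [e]
    exact gibbsExp_mul_sq_le H _ _
  · have := gibbsExp_mono H fun x => sq_le_sq' (neg_le_of_abs_le (hsup k x))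
      ((le_abs_self _).trans (hsup k x))
    rw [gibbsExp_const] at this
    refine this.trans_eq ?_
    rw [← pow_mul, mul_comm 2 k, pow_mul ρ k 2]
    ring

/-- **Poincaré inequality** under Dobrushin's condition: the variance is at most `1 / η` times the
Dirichlet form of Glauber dynamics. -/
theorem mul_gibbsVar_le [Nonempty V] {c : V → V → ℝ} {η : ℝ} (hη1 : η ≤ 1)
    (hc : ∀ v w, v ≠ w → ∀ x, |flipProb H w x - flipProb H w (flip v x)| ≤ c v w)
    (hη : ∀ v, ∑ w ∈ Finset.univ.erase v, c v w ≤ 1 - η) (f : (V → ℤˣ) → ℝ) :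
    η * gibbsVar H f ≤ (1 / 2) * ∑ v, gibbsExp H fun x => (f x - f (flip v x)) ^ 2 := by
  have hn : (0 : ℝ) < Fintype.card V := card_pos_real
  have hn1 : (1 : ℝ) ≤ Fintype.card V := by exact_mod_cast (Fintype.card_pos : 0 < Fintype.card V)
  set ρ : ℝ := 1 - η / Fintype.card V with hρ
  have hρ0 : 0 ≤ ρ := by
    rw [hρ, sub_nonneg, div_le_one hn]; linarith
  set g : (V → ℤˣ) → ℝ := fun x => f x - gibbsExp H f with hg
  have hg0 : gibbsExp H g = 0 := by rw [hg, gibbsExp_sub, gibbsExp_const, sub_self]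
  have hvar : gibbsVar H f = gibbsExp H fun x => g x ^ 2 := rfl
  have hnonneg : 0 ≤ gibbsExp H fun x => g x ^ 2 := gibbsExp_nonneg H fun _ => sq_nonneg _
  have hcs : gibbsExp H (fun x => g x * glauber H g x) ≤ ρ * gibbsExp H fun x => g x ^ 2 := by
    refine (abs_le_of_sq_le_sq' ?_ (mul_nonneg hρ0 hnonneg)).2
    refine (gibbsExp_mul_sq_le H _ _).trans ?_
    have := mul_le_mul_of_nonneg_left (gibbsExp_glauber_sq_le H hη1 hc hη hg0) hnonneg
    refine this.trans_eq ?_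
    ring
  have h := gibbsExp_mul_sub_glauber H g g
  simp only [← sq] at h
  have hle : Fintype.card V * ((gibbsExp H fun x => g x ^ 2) -
      gibbsExp H fun x => g x * glauber H g x) ≥ η * gibbsVar H f := by
    rw [hvar]
    calc _ ≥ Fintype.card V * ((gibbsExp H fun x => g x ^ 2) -
          ρ * gibbsExp H fun x => g x ^ 2) := by gcongr
      _ = _ := by rw [hρ]; field_simp; ring
  refine hle.le.trans (h.le.trans ?_)
  rw [Finset.mul_sum]
  refine Finset.sum_le_sum fun v _ => ?_
  rw [← gibbsExp_const_mul]
  refine gibbsExp_mono H fun x => ?_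
  have e : g x - g (flip v x) = f x - f (flip v x) := by simp [hg]
  rw [e]
  nlinarith [flipProb_le_one H v x, sq_nonneg (f x - f (flip v x))]

end Poincare

/-! ### Quadratic energies at high temperature -/

section Tanh

theorem hasDerivAt_tanh (x : ℝ) : HasDerivAt Real.tanh (1 / Real.cosh x ^ 2) x := by
  have e : Real.tanh = fun x => Real.sinh x / Real.cosh x :=
    funext Real.tanh_eq_sinh_div_cosh
  rw [e]
  refine ((Real.hasDerivAt_sinh x).div (Real.hasDerivAt_cosh x)
    (Real.cosh_pos x).ne').congr_deriv ?_
  rw [← Real.cosh_sq_sub_sinh_sq x]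
  ring

theorem differentiable_tanh : Differentiable ℝ Real.tanh := fun x =>
  (hasDerivAt_tanh x).differentiableAt

theorem tanh_monotone : Monotone Real.tanh :=
  monotone_of_deriv_nonneg differentiable_tanh fun x => by
    rw [(hasDerivAt_tanh x).deriv]; positivity

theorem tanh_add_le {s t : ℝ} (ht : 0 ≤ t) : Real.tanh (s + t) ≤ Real.tanh s + t := by
  have := image_sub_le_mul_sub_of_deriv_le differentiable_tanh (C := 1) (fun x => by
    rw [(hasDerivAt_tanh x).deriv, div_le_one (pow_pos (Real.cosh_pos x) 2)]
    exact one_le_pow₀ (Real.one_le_cosh x)) (x := s) (y := s + t) (by linarith)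
  linarith

theorem tanh_nonneg {t : ℝ} (ht : 0 ≤ t) : 0 ≤ Real.tanh t := by
  rw [Real.tanh_eq_sinh_div_cosh]
  exact div_nonneg (Real.sinh_nonneg_iff.2 ht) (Real.cosh_pos t).le

/-- Among intervals of length `2 * |t|`, the one centred at the origin maximizes the increment of
`tanh`. -/
theorem abs_tanh_sub_tanh_le (a t : ℝ) :
    |Real.tanh (a + t) - Real.tanh (a - t)| ≤ 2 * Real.tanh |t| := by
  have h1 := Real.cosh_pos (a + t)
  have h2 := Real.cosh_pos (a - t)
  have ht := Real.cosh_pos t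
  have e : Real.tanh (a + t) - Real.tanh (a - t) =
      2 * Real.sinh t * Real.cosh t / (Real.cosh (a + t) * Real.cosh (a - t)) := by
    rw [Real.tanh_eq_sinh_div_cosh, Real.tanh_eq_sinh_div_cosh, div_sub_div _ _ h1.ne' h2.ne']
    congr 1
    have h := Real.sinh_sub (a + t) (a - t)
    rw [add_sub_sub_cancel, ← two_mul, Real.sinh_two_mul] at h
    linarith
  have e' : Real.cosh (a + t) * Real.cosh (a - t) = Real.cosh t ^ 2 + Real.sinh a ^ 2 := by
    rw [Real.cosh_add, Real.cosh_sub]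
    have ha := Real.cosh_sq a
    have ht := Real.cosh_sq t
    have : Real.sinh t ^ 2 = Real.cosh t ^ 2 - 1 := by linarith
    linear_combination (Real.cosh t ^ 2) * ha - Real.sinh a ^ 2 * this
  rw [e, e', abs_div, abs_mul, abs_mul, abs_of_pos ht, abs_of_pos (two_pos : (0 : ℝ) < 2),
    abs_of_pos (by positivity : 0 < Real.cosh t ^ 2 + Real.sinh a ^ 2), Real.tanh_eq_sinh_div_cosh, Real.cosh_abs, ← Real.abs_sinh,
    div_le_iff₀ (by positivity)]
  have : 2 * (|Real.sinh t| / Real.cosh t) * (Real.cosh t ^ 2 + Real.sinh a ^ 2) =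
      2 * |Real.sinh t| * Real.cosh t + 2 * (|Real.sinh t| / Real.cosh t) * Real.sinh a ^ 2 := by
    field_simp
  rw [this]
  have : 0 ≤ 2 * (|Real.sinh t| / Real.cosh t) * Real.sinh a ^ 2 := by positivity
  linarith

end Tanh

section Pair

variable {V : Type*} [Fintype V] [DecidableEq V]

/-- The energy `∑ h_v x_v + (1 / 2) ∑ J_{uv} x_u x_v`. The matrix `J` may have a nonzero diagonal,
which only adds a constant since spins square to one. -/
noncomputable def pairEnergy (h : V → ℝ) (J : V → V → ℝ) (x : V → ℤˣ) : ℝ :=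
  ∑ v, h v * spin x v + (1 / 2) * ∑ u, ∑ v, J u v * spin x u * spin x v

/-- The quadratic form of `A` in the spins, centred at `m`. -/
noncomputable def quadForm (A : V → V → ℝ) (m : V → ℝ) (x : V → ℤˣ) : ℝ :=
  ∑ u, ∑ v, A u v * (spin x u - m u) * (spin x v - m v)

omit [Fintype V] [DecidableEq V] in
theorem spin_sq (x : V → ℤˣ) (v : V) : spin x v ^ 2 = 1 := by
  rcases Int.units_eq_one_or (x v) with h | h <;> simp [spin, h]

omit [Fintype V] [DecidableEq V] in
theorem abs_spin (x : V → ℤˣ) (v : V) : |spin x v| = 1 := by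
  rcases Int.units_eq_one_or (x v) with h | h <;> simp [spin, h]

omit [Fintype V] in
theorem spin_flip (x : V → ℤˣ) (v u : V) :
    spin (flip v x) u = spin x u + if u = v then -2 * spin x v else 0 := by
  rcases eq_or_ne u v with rfl | h
  · simp [spin, flip]; ring
  · simp [spin, flip, h]

theorem sum_mul_add_ite (b y : V → ℝ) (v : V) (t : ℝ) :
    ∑ u, b u * (y u + if u = v then t else 0) = ∑ u, b u * y u + b v * t := by
  simp [mul_add, Finset.sum_add_distrib]

theorem sum_sum_add_ite {J : V → V → ℝ} (hJ : ∀ u v, J u v = J v u) (y : V → ℝ) (v : V)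
    (t : ℝ) :
    ∑ u, ∑ w, J u w * (y u + if u = v then t else 0) * (y w + if w = v then t else 0) =
      ∑ u, ∑ w, J u w * y u * y w + 2 * t * ∑ w, J v w * y w + t ^ 2 * J v v := by
  have h1 : ∀ u, ∑ w, J u w * (y u + if u = v then t else 0) * (y w + if w = v then t else 0) =
      (∑ w, J u w * y w + J u v * t) * (y u + if u = v then t else 0) := fun u => by
    rw [← sum_mul_add_ite, Finset.sum_mul]
    exact Finset.sum_congr rfl fun w _ => by ring
  simp only [h1]
  rw [sum_mul_add_ite (fun u => ∑ w, J u w * y w + J u v * t)]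
  have h2 : ∑ u, (∑ w, J u w * y w + J u v * t) * y u =
      ∑ u, ∑ w, J u w * y u * y w + t * ∑ w, J v w * y w := by
    rw [Finset.mul_sum, ← Finset.sum_add_distrib]
    refine Finset.sum_congr rfl fun u _ => ?_
    rw [add_mul, Finset.sum_mul, hJ u v]
    congr 1
    · exact Finset.sum_congr rfl fun w _ => by ring
    · ring
  rw [h2]
  ring

/-- Half the drop in energy when the spin at `v` is reversed. -/
noncomputable def localField (h : V → ℝ) (J : V → V → ℝ) (v : V) (x : V → ℤˣ) : ℝ :=
  spin x v * (h v + ∑ w, J v w * spin x w) - J v v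

theorem pairEnergy_flip (h : V → ℝ) {J : V → V → ℝ} (hJ : ∀ u v, J u v = J v u) (v : V)
    (x : V → ℤˣ) :
    pairEnergy h J (flip v x) = pairEnergy h J x - 2 * localField h J v x := by
  simp only [pairEnergy, spin_flip, localField]
  rw [sum_mul_add_ite, sum_sum_add_ite hJ]
  linear_combination 2 * J v v * spin_sq x v

theorem flipProb_pairEnergy (h : V → ℝ) {J : V → V → ℝ} (hJ : ∀ u v, J u v = J v u) (v : V)
    (x : V → ℤˣ) :
    flipProb (pairEnergy h J) v x = (1 - Real.tanh (localField h J v x)) / 2 := by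
  rw [flipProb, pairEnergy_flip h hJ, Real.tanh_eq]
  set l := localField h J v x
  have e : Real.exp (pairEnergy h J x - 2 * l) =
      Real.exp (pairEnergy h J x) * (Real.exp (-l) * Real.exp (-l)) := by
    rw [← Real.exp_add, ← Real.exp_add]; ring_nf
  have e' : Real.exp (-l) * Real.exp l = 1 := by rw [← Real.exp_add]; simp
  have h0 := Real.exp_pos (pairEnergy h J x)
  have h1 := Real.exp_pos l
  have h2 := Real.exp_pos (-l)
  rw [e]
  field_simp
  linear_combination 2 * Real.exp (-l) * e'

/-- The influence of the spin at `v` on the heat-bath update at `w` is at most `tanh |J w v|`. -/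
theorem abs_flipProb_sub_flip_le (h : V → ℝ) {J : V → V → ℝ} (hJ : ∀ u v, J u v = J v u)
    {v w : V} (hvw : v ≠ w) (x : V → ℤˣ) :
    |flipProb (pairEnergy h J) w x - flipProb (pairEnergy h J) w (flip v x)| ≤
      Real.tanh |J w v| := by
  rw [flipProb_pairEnergy h hJ, flipProb_pairEnergy h hJ]
  set t := J w v * spin x w * spin x v with ht
  have e : localField h J w (flip v x) = localField h J w x - t - t := by
    simp only [localField, spin_flip, if_neg hvw.symm, sum_mul_add_ite, ht]
    ring
  have habs : |t| = |J w v| := by rw [ht, abs_mul, abs_mul, abs_spin, abs_spin, mul_one, mul_one]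
  have := abs_tanh_sub_tanh_le (localField h J w x - t) t
  rw [sub_add_cancel, habs] at this
  rw [e, ← sub_div, abs_div, abs_two, div_le_iff₀ two_pos, sub_sub_sub_cancel_left, abs_sub_comm]
  linarith

/-- Dobrushin's condition `∑_{w ≠ v} tanh |J v w| ≤ 1 - η`. -/
def Dobrushin (J : V → V → ℝ) (η : ℝ) : Prop :=
  ∀ v, ∑ w ∈ Finset.univ.erase v, Real.tanh |J v w| ≤ 1 - η

theorem Dobrushin.le_one [Nonempty V] {J : V → V → ℝ} {η : ℝ} (hη : Dobrushin J η) : η ≤ 1 := by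
  have v : V := Classical.arbitrary V
  have : 0 ≤ ∑ w ∈ Finset.univ.erase v, Real.tanh |J v w| :=
    Finset.sum_nonneg fun w _ => tanh_nonneg (abs_nonneg _)
  linarith [hη v]

theorem Dobrushin.mul_gibbsVar_le [Nonempty V] (h : V → ℝ) {J : V → V → ℝ} {η : ℝ}
    (hJ : ∀ u v, J u v = J v u) (hη : Dobrushin J η) (f : (V → ℤˣ) → ℝ) :
    η * gibbsVar (pairEnergy h J) f ≤
      (1 / 2) * ∑ v, gibbsExp (pairEnergy h J) fun x => (f x - f (flip v x)) ^ 2 := by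
  refine IsingModel.mul_gibbsVar_le (pairEnergy h J) (c := fun v w => Real.tanh |J w v|) hη.le_one
    (fun v w hvw x => abs_flipProb_sub_flip_le h hJ hvw x) (fun v => ?_) f
  simpa only [hJ _ v] using hη v

/-- Linear functions have variance at most `2 ‖b‖² / η`. -/
theorem Dobrushin.mul_gibbsVar_linear_le [Nonempty V] (h : V → ℝ) {J : V → V → ℝ} {η : ℝ}
    (hJ : ∀ u v, J u v = J v u) (hη : Dobrushin J η) (b : V → ℝ) :
    η * gibbsVar (pairEnergy h J) (fun x => ∑ u, b u * spin x u) ≤ 2 * ∑ u, b u ^ 2 := by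
  refine (hη.mul_gibbsVar_le h hJ _).trans_eq ?_
  have e : ∀ v x, (∑ u, b u * spin x u - ∑ u, b u * spin (flip v x) u) ^ 2 = 4 * b v ^ 2 :=
    fun v x => by
      simp only [spin_flip, sum_mul_add_ite]
      linear_combination 4 * b v ^ 2 * spin_sq x v
  simp only [e, gibbsExp_const, ← Finset.mul_sum]
  ring

theorem quadForm_sub_flip {A : V → V → ℝ} (hA : ∀ u v, A u v = A v u) (m : V → ℝ) (v : V)
    (x : V → ℤˣ) :
    quadForm A m x - quadForm A m (flip v x) =
      4 * spin x v * (∑ u, A v u * spin x u - ∑ u, A v u * m u) - 4 * A v v := by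
  have e : ∀ u, spin (flip v x) u - m u =
      (spin x u - m u) + if u = v then -2 * spin x v else 0 := fun u => by rw [spin_flip]; ring
  simp only [quadForm, e, sum_sum_add_ite hA, ← Finset.sum_sub_distrib, ← mul_sub]
  linear_combination (-4) * A v v * spin_sq x v

theorem gibbsExp_linear (H : (V → ℤˣ) → ℝ) (b : V → ℝ) :
    gibbsExp H (fun x => ∑ u, b u * spin x u) = ∑ u, b u * gibbsExp H fun x => spin x u := by
  rw [gibbsExp_sum]
  exact Finset.sum_congr rfl fun u _ => gibbsExp_const_mul _ _ _

/-- The variance of a quadratic form, by two applications of the Poincaré inequality: the discrete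
gradient of the form is linear. The form need not be centred at the mean, which costs the term
with the squared distance of the centre from the mean. -/
theorem Dobrushin.gibbsVar_quadForm_le [Nonempty V] (h : V → ℝ) {J A : V → V → ℝ} {η : ℝ}
    (hJ : ∀ u v, J u v = J v u) (hη : Dobrushin J η) (hη0 : 0 < η) (hA : ∀ u v, A u v = A v u)
    (hA1 : ∀ u v, |A u v| ≤ 1) (m : V → ℝ) :
    gibbsVar (pairEnergy h J) (quadForm A m) ≤ 48 * (Fintype.card V / η) ^ 2 +
      16 * Fintype.card V ^ 2 / η *
        ∑ u, (gibbsExp (pairEnergy h J) (fun x => spin x u) - m u) ^ 2 := by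
  set H := pairEnergy h J with hH
  set n : ℝ := (Fintype.card V : ℝ) with hn
  set D := ∑ u, (gibbsExp H (fun x => spin x u) - m u) ^ 2 with hD
  have hn1 : (1 : ℝ) ≤ n := by
    rw [hn]; exact_mod_cast (Fintype.card_pos : 0 < Fintype.card V)
  have hA2 : ∀ u v, A u v ^ 2 ≤ 1 := fun u v => (sq_le_one_iff_abs_le_one _).2 (hA1 u v)
  have hrow : ∀ v, ∑ u, A v u ^ 2 ≤ n := fun v => by
    simpa [hn] using Finset.sum_le_card_nsmul Finset.univ (fun u => A v u ^ 2) 1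
      fun u _ => hA2 v u
  have hgrad : ∀ v, gibbsExp H (fun x => (∑ u, A v u * spin x u - ∑ u, A v u * m u) ^ 2) ≤
      2 * n / η + n * D := by
    intro v
    rw [gibbsExp_sub_sq]
    refine add_le_add ?_ ?_
    · rw [le_div_iff₀ hη0, mul_comm]
      exact (hη.mul_gibbsVar_linear_le h hJ (A v)).trans (by linarith [hrow v])
    · rw [gibbsExp_linear, ← Finset.sum_sub_distrib]
      simp only [← mul_sub]
      refine (Finset.sum_mul_sq_le_sq_mul_sq _ _ _).trans ?_
      exact mul_le_mul_of_nonneg_right (hrow v) (Finset.sum_nonneg fun _ _ => sq_nonneg _)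
  have hflip : ∀ v, gibbsExp H (fun x => (quadForm A m x - quadForm A m (flip v x)) ^ 2) ≤
      32 * (2 * n / η + n * D) + 32 := by
    intro v
    refine le_trans ?_ (add_le_add_left (mul_le_mul_of_nonneg_left (hgrad v) (by norm_num)) 32)
    rw [← gibbsExp_const_mul, ← gibbsExp_const H 32, ← gibbsExp_add]
    refine gibbsExp_mono H fun x => ?_
    rw [quadForm_sub_flip hA, gibbsExp_const]
    set L := ∑ u, A v u * spin x u - ∑ u, A v u * m u
    nlinarith [sq_nonneg (4 * spin x v * L + 4 * A v v), hA2 v v, spin_sq x v,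
      congrArg (fun z => z * L ^ 2) (spin_sq x v)]
  have hsum := (hη.mul_gibbsVar_le h hJ (quadForm A m)).trans
    (mul_le_mul_of_nonneg_left (Finset.sum_le_card_nsmul Finset.univ _ _ fun v _ => hflip v)
      (by norm_num : (0 : ℝ) ≤ 1 / 2))
  rw [nsmul_eq_mul, Finset.card_univ, ← hn, ← hH] at hsum
  have hnn : n ≤ n ^ 2 / η := by
    rw [le_div_iff₀ hη0]; nlinarith [hη.le_one]
  have : η * gibbsVar H (quadForm A m) ≤ 48 * n ^ 2 / η + 16 * n ^ 2 * D := by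
    calc _ ≤ _ := hsum
      _ = 32 * n ^ 2 / η + 16 * n ^ 2 * D + 16 * n := by ring
      _ ≤ 32 * n ^ 2 / η + 16 * n ^ 2 * D + 16 * (n ^ 2 / η) := by gcongr
      _ = _ := by ring
  rw [mul_comm, ← le_div_iff₀ hη0] at this
  refine this.trans_eq ?_
  field_simp

omit [DecidableEq V] in
/-- Tilting by a quadratic form changes the couplings and the external field only, up to an
additive constant. -/
theorem pairEnergy_add_mul_quadForm (h : V → ℝ) (J : V → V → ℝ) {A : V → V → ℝ}
    (hA : ∀ u v, A u v = A v u) (m : V → ℝ) (s : ℝ) (x : V → ℤˣ) :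
    pairEnergy h J x + s * quadForm A m x =
      pairEnergy (fun v => h v - 2 * s * ∑ u, A v u * m u) (fun u v => J u v + 2 * s * A u v) x +
        s * ∑ u, ∑ v, A u v * m u * m v := by
  have e1 : quadForm A m x = ∑ u, ∑ v, A u v * spin x u * spin x v -
      2 * ∑ v, (∑ u, A v u * m u) * spin x v + ∑ u, ∑ v, A u v * m u * m v := by
    have e2 : ∑ u, ∑ v, A u v * m u * spin x v = ∑ v, (∑ u, A v u * m u) * spin x v := by
      rw [Finset.sum_comm]
      simp only [Finset.sum_mul, hA]
    have e3 : ∑ u, ∑ v, A u v * spin x u * m v = ∑ v, (∑ u, A v u * m u) * spin x v := by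
      simp only [Finset.sum_mul]
      exact Finset.sum_congr rfl fun u _ => Finset.sum_congr rfl fun v _ => by ring
    have e4 : ∀ u v, A u v * (spin x u - m u) * (spin x v - m v) = A u v * spin x u * spin x v -
        A u v * m u * spin x v - A u v * spin x u * m v + A u v * m u * m v := fun u v => by ring
    simp only [quadForm, e4, Finset.sum_add_distrib, Finset.sum_sub_distrib, e2, e3]
    ring
  rw [e1]
  have e5 : ∑ u, ∑ v, (J u v + 2 * s * A u v) * spin x u * spin x v =
      ∑ u, ∑ v, J u v * spin x u * spin x v +
        2 * s * ∑ u, ∑ v, A u v * spin x u * spin x v := by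
    simp only [Finset.mul_sum, ← Finset.sum_add_distrib]
    exact Finset.sum_congr rfl fun u _ => Finset.sum_congr rfl fun v _ => by ring
  have e6 : ∑ v, (h v - 2 * s * ∑ u, A v u * m u) * spin x v =
      ∑ v, h v * spin x v - 2 * s * ∑ v, (∑ u, A v u * m u) * spin x v := by
    rw [Finset.mul_sum, ← Finset.sum_sub_distrib]
    exact Finset.sum_congr rfl fun v _ => by ring
  simp only [pairEnergy, e5, e6]
  ring

/-- A perturbation of the couplings of relative size `η / n` keeps half of the temperature gap. -/
theorem Dobrushin.add {J A : V → V → ℝ} {η s : ℝ} (hη : Dobrushin J η)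
    (hA1 : ∀ u v, |A u v| ≤ 1) (hs : 0 ≤ s) (hs' : 4 * s * Fintype.card V ≤ η) :
    Dobrushin (fun u v => J u v + 2 * s * A u v) (η / 2) := by
  intro v
  have h1 : ∀ w, Real.tanh |J v w + 2 * s * A v w| ≤ Real.tanh |J v w| + 2 * s := by
    intro w
    have h2 : |J v w + 2 * s * A v w| ≤ |J v w| + 2 * s := by
      refine (abs_add_le _ _).trans (add_le_add_right ?_ _)
      rw [abs_mul, abs_of_nonneg (by linarith : 0 ≤ 2 * s)]
      exact mul_le_of_le_one_right (by linarith) (hA1 v w)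
    exact (tanh_monotone h2).trans (tanh_add_le (by linarith))
  refine (Finset.sum_le_sum fun w _ => h1 w).trans ?_
  rw [Finset.sum_add_distrib, Finset.sum_const, nsmul_eq_mul]
  have h3 : ((Finset.univ.erase v).card : ℝ) ≤ Fintype.card V := by
    exact_mod_cast (Finset.card_le_univ _)
  nlinarith [hη v]

/-- The exponential moment of a quadratic form in the centred spins, at the scale `η / n`.
Along the tilt by the form the model stays at high temperature. If `W` is the largest variance of
the form along the tilt, then by Cauchy–Schwarz the mean vector moves by at most
`O(√(W / η) · η / n)`, and inserting this into the variance bound for quadratic forms leaves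
`W ≤ O(n² / η²) + W / 8`. -/
theorem Dobrushin.gibbsExp_exp_quadForm_le [Nonempty V] (h : V → ℝ) {J A : V → V → ℝ} {η : ℝ}
    (hJ : ∀ u v, J u v = J v u) (hη : Dobrushin J η) (hη0 : 0 < η) (hA : ∀ u v, A u v = A v u)
    (hA1 : ∀ u v, |A u v| ≤ 1) {m : V → ℝ}
    (hm : ∀ u, m u = gibbsExp (pairEnergy h J) fun x => spin x u) :
    gibbsExp (pairEnergy h J) (fun x => Real.exp (η / (32 * Fintype.card V) *
      (quadForm A m x - gibbsExp (pairEnergy h J) (quadForm A m)))) ≤ 2 := by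
  set H := pairEnergy h J with hH
  set f := quadForm A m with hf
  set n : ℝ := (Fintype.card V : ℝ) with hn
  have hn0 : 0 < n := card_pos_real
  set T := η / (32 * n) with hT
  have hT0 : 0 ≤ T := by positivity
  have hTn : T * n = η / 32 := by rw [hT]; field_simp
  have hdob : ∀ s ∈ Set.Icc 0 T, Dobrushin (fun u v => J u v + 2 * s * A u v) (η / 2) :=
    fun s hs => hη.add hA1 hs.1 (by
      have := mul_le_mul_of_nonneg_right hs.2 hn0.le
      linarith)
  have hsymm : ∀ s u v, J u v + 2 * s * A u v = J v u + 2 * s * A v u := fun s u v => by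
    rw [hJ, hA]
  have htilt : ∀ s, (fun x => H x + s * f x) = fun x =>
      pairEnergy (fun v => h v - 2 * s * ∑ u, A v u * m u) (fun u v => J u v + 2 * s * A u v) x +
        s * ∑ u, ∑ v, A u v * m u * m v := fun s =>
    funext fun x => pairEnergy_add_mul_quadForm h J hA m s x
  -- `s` is the tilt of largest variance; the drift of the mean is needed at this `s` only
  obtain ⟨s, hs, hmax⟩ := isCompact_Icc.exists_isMaxOn (Set.nonempty_Icc.2 hT0)
    (continuous_gibbsVar_tilt H f).continuousOn
  set W := gibbsVar (fun x => H x + s * f x) f with hW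
  have hV : ∀ t ∈ Set.Icc 0 T, gibbsVar (fun x => H x + t * f x) f ≤ W := fun t ht => hmax ht
  have hW0 : 0 ≤ W := gibbsVar_nonneg _ _
  set b : V → ℝ := fun u => gibbsExp (fun x => H x + s * f x) (fun x => spin x u) - m u with hb
  set D := ∑ u, b u ^ 2 with hD
  have hD0 : 0 ≤ D := Finset.sum_nonneg fun _ _ => sq_nonneg _
  -- the drift `b` is tested against the linear function with coefficients `b`
  have hdrift : D ≤ 4 * W / η * T ^ 2 := by
    have h1 := gibbsExp_tilt_sub_le H f (fun x => ∑ u, b u * spin x u) (W := 2 * D / (η / 2)) hs.1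
      (fun t ht => hV t ⟨ht.1, ht.2.trans hs.2⟩) (fun t ht => by
        rw [htilt, gibbsVar_add_const, le_div_iff₀ (half_pos hη0), mul_comm]
        exact (hdob t ⟨ht.1, ht.2.trans hs.2⟩).mul_gibbsVar_linear_le _ (hsymm t) b)
    rw [gibbsExp_linear, gibbsExp_linear, ← Finset.sum_sub_distrib] at h1
    have h2 : ∑ u, (b u * gibbsExp (fun x => H x + s * f x) (fun x => spin x u) -
        b u * gibbsExp H fun x => spin x u) = D := Finset.sum_congr rfl fun u _ => by
      rw [← hm u]; simp only [hb]; ring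
    rw [h2] at h1
    have h3 : D ≤ Real.sqrt (2 * D / (η / 2) * W) * T :=
      h1.trans (mul_le_mul_of_nonneg_left hs.2 (Real.sqrt_nonneg _))
    have h4 : D ^ 2 ≤ 2 * D / (η / 2) * W * T ^ 2 := by
      have := pow_le_pow_left₀ hD0 h3 2
      rwa [mul_pow, Real.sq_sqrt (by positivity)] at this
    rcases hD0.eq_or_lt with h0 | h0
    · rw [← h0]; positivity
    · refine le_of_mul_le_mul_left ?_ h0
      calc D * D = D ^ 2 := (sq D).symm
        _ ≤ _ := h4
        _ = _ := by field_simp; ring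
  have hself : W ≤ 48 * (n / (η / 2)) ^ 2 + 16 * n ^ 2 / (η / 2) * D := by
    have := (hdob s hs).gibbsVar_quadForm_le (fun v => h v - 2 * s * ∑ u, A v u * m u) (hsymm s)
      (half_pos hη0) hA hA1 m
    rw [hW, hD, hb]
    simpa only [htilt, gibbsVar_add_const, gibbsExp_add_const] using this
  have hWT : W * T ^ 2 ≤ 1 / 4 := by
    have h1 : W ≤ 48 * (n / (η / 2)) ^ 2 + 16 * n ^ 2 / (η / 2) * (4 * W / η * T ^ 2) :=
      hself.trans (by gcongr)
    have h2 : 16 * n ^ 2 / (η / 2) * (4 * W / η * T ^ 2) = W / 8 := by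
      calc _ = 128 * W / η ^ 2 * (T * n) ^ 2 := by field_simp; ring
        _ = _ := by rw [hTn]; field_simp; ring
    have h3 : 48 * (n / (η / 2)) ^ 2 * T ^ 2 = 3 / 16 := by
      calc _ = 192 / η ^ 2 * (T * n) ^ 2 := by field_simp; ring
        _ = _ := by rw [hTn]; field_simp; ring
    rw [h2] at h1
    have := mul_le_mul_of_nonneg_right h1 (sq_nonneg T)
    rw [add_mul, h3] at this
    linarith
  refine (gibbsExp_exp_le H f hT0 hV).trans ?_
  rw [← Real.exp_log (two_pos : (0 : ℝ) < 2), Real.exp_le_exp]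
  linarith [Real.log_two_gt_d9]

end Pair

/-! ### Tail bounds for the law of the Ising model -/

section Tail

variable {V : Type*} [Fintype V] [DecidableEq V]

/-- Both tails of a function from its centred exponential moments at `±T`. -/
theorem gibbsExp_indicator_le {S : Type*} [Fintype S] (H f : S → ℝ) {T K r : ℝ} (hT : 0 ≤ T)
    (h1 : gibbsExp H (fun x => Real.exp (T * (f x - gibbsExp H f))) ≤ K)
    (h2 : gibbsExp H (fun x => Real.exp (T * (-f x - gibbsExp H fun x => -f x))) ≤ K) :
    gibbsExp H ({x | r ≤ |f x - gibbsExp H f|}.indicator fun _ => 1) ≤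
      2 * K * Real.exp (-(T * r)) := by
  have hneg : gibbsExp H (fun x => -f x) = -gibbsExp H f := by
    simpa using gibbsExp_const_mul H (-1) f
  rw [hneg] at h2
  have h3 : gibbsExp H ({x | r ≤ |f x - gibbsExp H f|}.indicator fun _ => 1) ≤
      gibbsExp H fun x => Real.exp (-(T * r)) * (Real.exp (T * (f x - gibbsExp H f)) +
        Real.exp (T * (-f x - -gibbsExp H f))) := by
    refine gibbsExp_mono H fun x => Set.indicator_apply_le' (fun hx => ?_) fun _ => by positivity
    have hx : r ≤ |f x - gibbsExp H f| := hx
    rw [mul_add, ← Real.exp_add, ← Real.exp_add]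
    rcases le_abs.1 hx with h | h
    · have : 1 ≤ Real.exp (-(T * r) + T * (f x - gibbsExp H f)) :=
        Real.one_le_exp (by nlinarith)
      linarith [Real.exp_pos (-(T * r) + T * (-f x - -gibbsExp H f))]
    · have : 1 ≤ Real.exp (-(T * r) + T * (-f x - -gibbsExp H f)) :=
        Real.one_le_exp (by nlinarith)
      linarith [Real.exp_pos (-(T * r) + T * (f x - gibbsExp H f))]
  refine h3.trans ?_
  rw [gibbsExp_const_mul, gibbsExp_add]
  nlinarith [Real.exp_pos (-(T * r))]

omit [DecidableEq V] in
/-- Only the symmetric part of the coefficient matrix matters. -/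
theorem quadForm_symm (a : V → V → ℝ) (m : V → ℝ) :
    quadForm (fun u v => (a u v + a v u) / 2) m = quadForm a m := by
  ext x
  have h : ∑ u, ∑ v, a v u * (spin x u - m u) * (spin x v - m v) = quadForm a m x := by
    rw [Finset.sum_comm]
    exact Finset.sum_congr rfl fun u _ => Finset.sum_congr rfl fun v _ => by ring
  have h' : quadForm (fun u v => (a u v + a v u) / 2) m x = (1 / 2) * (quadForm a m x +
      ∑ u, ∑ v, a v u * (spin x u - m u) * (spin x v - m v)) := by
    simp only [quadForm, ← Finset.sum_add_distrib, Finset.mul_sum]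
    exact Finset.sum_congr rfl fun u _ => Finset.sum_congr rfl fun v _ => by ring
  rw [h', h]
  ring

theorem Dobrushin.gibbsExp_tail_le [Nonempty V] (h : V → ℝ) {J a : V → V → ℝ} {η : ℝ}
    (hJ : ∀ u v, J u v = J v u) (hη : Dobrushin J η) (hη0 : 0 < η)
    (ha : ∀ u v, |a u v| ≤ 1) {m : V → ℝ}
    (hm : ∀ u, m u = gibbsExp (pairEnergy h J) fun x => spin x u) (r : ℝ) :
    gibbsExp (pairEnergy h J) ({x | r ≤ |quadForm a m x -
      gibbsExp (pairEnergy h J) (quadForm a m)|}.indicator fun _ => 1) ≤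
        4 * Real.exp (-(η / (32 * Fintype.card V) * r)) := by
  have hA1 : ∀ u v, |(a u v + a v u) / 2| ≤ 1 := fun u v => by
    rw [abs_div, abs_two, div_le_one two_pos]
    linarith [abs_add_le (a u v) (a v u), ha u v, ha v u]
  rw [← quadForm_symm]
  set A : V → V → ℝ := fun u v => (a u v + a v u) / 2 with hA
  have hsymm : ∀ u v, A u v = A v u := fun u v => by simp only [hA, add_comm]
  have hneg : quadForm (fun u v => -A u v) m = fun x => -quadForm A m x := by
    ext x
    simp only [quadForm, neg_mul, Finset.sum_neg_distrib]
  have h1 := hη.gibbsExp_exp_quadForm_le h hJ hη0 hsymm hA1 hm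
  have h2 := hη.gibbsExp_exp_quadForm_le h hJ hη0 (A := fun u v => -A u v)
    (fun u v => by rw [hsymm]) (fun u v => by rw [abs_neg]; exact hA1 u v) hm
  rw [hneg] at h2
  refine (gibbsExp_indicator_le _ _ (by positivity) h1 h2).trans_eq ?_
  norm_num

theorem IsHighTemperature.dobrushin {p : IsingModel V} {η : ℝ} (h : p.IsHighTemperature η) :
    Dobrushin p.coupling η := fun v => by
  simpa only [p.coupling_symm v] using h.2 v

theorem integral_law (p : IsingModel V) (f : (V → ℤˣ) → ℝ) :
    ∫ x, f x ∂p.law = gibbsExp p.energy f := by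
  rw [law, PMF.integral_eq_sum, gibbsExp, Finset.sum_div]
  refine Finset.sum_congr rfl fun x _ => ?_
  rw [pmf, PMF.ofFintype_apply, ENNReal.toReal_ofReal
    (div_nonneg (Real.exp_pos _).le p.partitionFunction_pos.le), smul_eq_mul, div_mul_eq_mul_div]
  rfl

variable {Ω : Type*} [MeasurableSpace Ω] {P : Measure Ω} {p : IsingModel V}

theorem integral_comp_of_hasLaw {X : Ω → V → ℤˣ} (hX : HasLaw X p.law P)
    (f : (V → ℤˣ) → ℝ) : ∫ ω, f (X ω) ∂P = gibbsExp p.energy f := by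
  rw [← integral_law]
  exact hX.integral_comp Measurable.of_discrete.aestronglyMeasurable

theorem measureReal_of_hasLaw {X : Ω → V → ℤˣ} (hX : HasLaw X p.law P) (s : Set (V → ℤˣ)) :
    P.real {ω | X ω ∈ s} = gibbsExp p.energy (s.indicator fun _ => 1) := by
  rw [hX.measureReal_eq MeasurableSet.of_discrete, ← integral_law]
  exact (integral_indicator_one MeasurableSet.of_discrete).symm

/-- The tail bound for centred bilinear functions, without logarithmic factors and for all `r`. -/
theorem measureReal_centeredBilinear_le [Nonempty V] {η : ℝ} (hη : p.IsHighTemperature η)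
    {a : V → V → ℝ} (ha : ∀ u v, |a u v| ≤ 1) {X : Ω → V → ℤˣ} (hX : HasLaw X p.law P) (r : ℝ) :
    P.real {ω | r ≤ |centeredBilinear P a X ω - ∫ ω', centeredBilinear P a X ω' ∂P|} ≤
      4 * Real.exp (-(η / (32 * Fintype.card V) * r)) := by
  set m : V → ℝ := fun u => gibbsExp p.energy fun x => spin x u with hm
  have hm' : ∀ u, ∫ ω, spin (X ω) u ∂P = m u := fun u =>
    integral_comp_of_hasLaw hX fun x => spin x u
  have e : ∀ ω, centeredBilinear P a X ω = quadForm a m (X ω) := fun ω => by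
    simp only [centeredBilinear, quadForm, hm']
  simp only [e, integral_comp_of_hasLaw hX]
  refine (measureReal_of_hasLaw hX {x | r ≤ |quadForm a m x -
    gibbsExp p.energy (quadForm a m)|}).trans_le ?_
  exact hη.dobrushin.gibbsExp_tail_le p.field p.coupling_symm hη.1 ha (fun _ => rfl) r

end Tail

/-! ### Two independent samples as one Ising model -/

section Double

variable {V : Type*}

/-- Two non-interacting copies of an Ising model, as an Ising model on the disjoint union. -/
def double (p : IsingModel V) : IsingModel (V ⊕ V) where
  graph := p.graph ⊕g p.graph
  field := Sum.elim p.field p.field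
  coupling
    | .inl u, .inl v => p.coupling u v
    | .inr u, .inr v => p.coupling u v
    | _, _ => 0
  coupling_symm := by
    rintro (u | u) (v | v) <;> simp [p.coupling_symm u v]
  coupling_eq_zero := by
    rintro (u | u) (v | v) h
    · exact p.coupling_eq_zero u v h
    · rfl
    · rfl
    · exact p.coupling_eq_zero u v h

/-- The coefficients `(a, -a; -a, a)` that express the bilinear function of a difference as a
bilinear function of the pair. -/
def doubleCoeff (a : V → V → ℝ) : V ⊕ V → V ⊕ V → ℝ
  | .inl u, .inl v => a u v
  | .inr u, .inr v => a u v
  | .inl u, .inr v => -a u v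
  | .inr u, .inl v => -a u v

theorem abs_doubleCoeff_le {a : V → V → ℝ} (ha : ∀ u v, |a u v| ≤ 1) :
    ∀ u v, |doubleCoeff a u v| ≤ 1 := by
  rintro (u | u) (v | v) <;> simp [doubleCoeff, ha u v]

variable [Fintype V] [DecidableEq V]

theorem IsHighTemperature.double {p : IsingModel V} {η : ℝ} (h : p.IsHighTemperature η) :
    p.double.IsHighTemperature η := by
  have hdiag : ∀ v, Real.tanh |p.coupling v v| = 0 := fun v => by
    rw [p.coupling_eq_zero v v (SimpleGraph.irrefl _), abs_zero, Real.tanh_zero]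
  have hsum : ∀ v, ∑ u, Real.tanh |p.coupling u v| ≤ 1 - η := fun v => by
    rw [← Finset.sum_erase (a := v) (f := fun u => Real.tanh |p.coupling u v|) _ (hdiag v)]
    exact h.2 v
  refine ⟨h.1, ?_⟩
  rintro (v | v) <;>
    refine (Finset.sum_le_sum_of_subset_of_nonneg (Finset.erase_subset _ _)
      fun u _ _ => tanh_nonneg (abs_nonneg _)).trans ?_ <;>
    simpa [Fintype.sum_sum_type, IsingModel.double] using hsum v

omit [DecidableEq V] in
theorem energy_double (p : IsingModel V) (z : V ⊕ V → ℤˣ) :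
    p.double.energy z = p.energy (z ∘ Sum.inl) + p.energy (z ∘ Sum.inr) := by
  simp only [energy, Fintype.sum_sum_type, double, Sum.elim_inl, Sum.elim_inr, zero_mul,
    Finset.sum_const_zero, add_zero, zero_add, spin, Function.comp_apply]
  ring

theorem partitionFunction_double (p : IsingModel V) :
    p.double.partitionFunction = p.partitionFunction * p.partitionFunction := by
  simp only [partitionFunction, energy_double, Real.exp_add]
  rw [Finset.sum_mul_sum, ← Fintype.sum_prod_type']
  exact Fintype.sum_equiv (Equiv.sumArrowEquivProdArrow V V ℤˣ) _ _ fun z => rfl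

variable {Ω : Type*} [MeasurableSpace Ω] {P : Measure Ω} [IsProbabilityMeasure P]
  {p : IsingModel V}

theorem hasLaw_sumElim {X₁ X₂ : Ω → V → ℤˣ} (h₁ : HasLaw X₁ p.law P) (h₂ : HasLaw X₂ p.law P)
    (hind : IndepFun X₁ X₂ P) :
    HasLaw (fun ω => Sum.elim (X₁ ω) (X₂ ω)) p.double.law P := by
  have hprod := (indepFun_iff_hasLaw_prodMk_prod h₁ h₂).1 hind
  have hlaw : HasLaw (fun z : (V → ℤˣ) × (V → ℤˣ) => Sum.elim z.1 z.2) p.double.law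
      (p.law.prod p.law) := by
    refine ⟨Measurable.of_discrete.aemeasurable, ?_⟩
    refine Measure.ext_of_singleton fun z => ?_
    have hpre : (fun z : (V → ℤˣ) × (V → ℤˣ) => Sum.elim z.1 z.2) ⁻¹' {z} =
        {z ∘ Sum.inl} ×ˢ {z ∘ Sum.inr} := by
      ext ⟨x, y⟩
      simp only [Set.mem_preimage, Set.mem_singleton_iff, Set.mem_prod]
      constructor
      · rintro rfl; exact ⟨rfl, rfl⟩
      · rintro ⟨rfl, rfl⟩; exact Sum.elim_comp_inl_inr z
    have hpos := p.partitionFunction_pos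
    rw [Measure.map_apply Measurable.of_discrete (measurableSet_singleton z), hpre,
      Measure.prod_prod]
    simp only [law, PMF.toMeasure_apply_singleton _ _ (measurableSet_singleton _), pmf,
      PMF.ofFintype_apply]
    rw [← ENNReal.ofReal_mul (by positivity), partitionFunction_double, energy_double,
      Real.exp_add, div_mul_div_comm]
  exact hlaw.fun_comp hprod

omit [DecidableEq V] [IsProbabilityMeasure P] in
theorem centeredBilinear_doubleCoeff (a : V → V → ℝ) {X₁ X₂ : Ω → V → ℤˣ}
    (hmean : ∀ u, ∫ ω, spin (X₁ ω) u ∂P = ∫ ω, spin (X₂ ω) u ∂P) (ω : Ω) :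
    centeredBilinear P (doubleCoeff a) (fun ω => Sum.elim (X₁ ω) (X₂ ω)) ω =
      differenceBilinear a (X₁ ω) (X₂ ω) := by
  have h1 : ∀ ω u, spin (Sum.elim (X₁ ω) (X₂ ω)) (Sum.inl u) = spin (X₁ ω) u := fun _ _ => rfl
  have h2 : ∀ ω u, spin (Sum.elim (X₁ ω) (X₂ ω)) (Sum.inr u) = spin (X₂ ω) u := fun _ _ => rfl
  simp only [centeredBilinear, differenceBilinear, Fintype.sum_sum_type, h1, h2, hmean,
    ← Finset.sum_add_distrib, doubleCoeff]
  exact Finset.sum_congr rfl fun u _ => Finset.sum_congr rfl fun v _ => by ring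

/-- The tail bound for bilinear functions of the difference of two independent samples, without
logarithmic factors and for all `r`. -/
theorem measureReal_differenceBilinear_le [Nonempty V] {η : ℝ} (hη : p.IsHighTemperature η)
    {a : V → V → ℝ} (ha : ∀ u v, |a u v| ≤ 1) {X₁ X₂ : Ω → V → ℤˣ} (h₁ : HasLaw X₁ p.law P)
    (h₂ : HasLaw X₂ p.law P) (hind : IndepFun X₁ X₂ P) (r : ℝ) :
    P.real {ω | r ≤ |differenceBilinear a (X₁ ω) (X₂ ω) -
      ∫ ω', differenceBilinear a (X₁ ω') (X₂ ω') ∂P|} ≤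
      4 * Real.exp (-(η / (64 * Fintype.card V) * r)) := by
  have hmean : ∀ u, ∫ ω, spin (X₁ ω) u ∂P = ∫ ω, spin (X₂ ω) u ∂P := fun u => by
    rw [integral_comp_of_hasLaw h₁ fun x => spin x u, integral_comp_of_hasLaw h₂ fun x => spin x u]
  have := measureReal_centeredBilinear_le hη.double (abs_doubleCoeff_le ha)
    (hasLaw_sumElim h₁ h₂ hind) r
  simp only [centeredBilinear_doubleCoeff a hmean, Fintype.card_sum] at this
  refine this.trans_eq ?_
  push_cast
  ring_nf

end Double

/-- Since `log n ≥ log 2`, the logarithm in the exponent only weakens a bound without it. -/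
theorem exp_neg_le_exp_neg_log {n : ℕ} {η K r : ℝ} (hn : 2 ≤ n) (hη : 0 ≤ η) (hK : 0 < K)
    (hK' : K ≤ 64) (hr : 0 ≤ r) :
    Real.exp (-(η / (K * n) * r)) ≤ Real.exp (-(η * r / (100 * n * Real.log n))) := by
  have hn2 : (2 : ℝ) ≤ n := by exact_mod_cast hn
  have hlog : 0.69 ≤ Real.log n := by
    have := Real.log_le_log two_pos hn2
    linarith [Real.log_two_gt_d9]
  rw [Real.exp_le_exp, neg_le_neg_iff, div_mul_eq_mul_div]
  refine div_le_div_of_nonneg_left (mul_nonneg hη hr) (by positivity) ?_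
  nlinarith

theorem nonneg_of_threshold_le {n : ℕ} {η r : ℝ} (hη : 0 ≤ η)
    (h : 1 * (n : ℝ) * Real.log n ^ 2 / η ≤ r) : 0 ≤ r :=
  le_trans (by positivity) h

end IsingModel

theorem theorem3p10 :
    (∃ c c' : ℝ, 0 < c ∧ 0 < c' ∧
      ∀ (V : Type*) [Fintype V] [DecidableEq V] (p : IsingModel V) (η : ℝ) (a : V → V → ℝ),
        2 ≤ Fintype.card V → p.IsHighTemperature η → (∀ u v, |a u v| ≤ 1) →
        ∀ (Ω : Type*) [MeasurableSpace Ω] (P : Measure Ω) [IsProbabilityMeasure P]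
          (X : Ω → V → ℤˣ), HasLaw X p.law P →
        ∀ r : ℝ, c * Fintype.card V * Real.log (Fintype.card V) ^ 2 / η ≤ r →
          P.real {ω | r ≤ |IsingModel.centeredBilinear P a X ω
              - ∫ ω', IsingModel.centeredBilinear P a X ω' ∂P|}
            ≤ 4 * Real.exp
                (-(η * r / (c' * Fintype.card V * Real.log (Fintype.card V))))) ∧
    (∃ c c' : ℝ, 0 < c ∧ 0 < c' ∧
      ∀ (V : Type*) [Fintype V] [DecidableEq V] (p : IsingModel V) (η : ℝ) (a : V → V → ℝ),
        2 ≤ Fintype.card V → p.IsHighTemperature η → (∀ u v, |a u v| ≤ 1) →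
        ∀ (Ω : Type*) [MeasurableSpace Ω] (P : Measure Ω) [IsProbabilityMeasure P]
          (X₁ X₂ : Ω → V → ℤˣ), HasLaw X₁ p.law P → HasLaw X₂ p.law P → IndepFun X₁ X₂ P →
        ∀ r : ℝ, c * Fintype.card V * Real.log (Fintype.card V) ^ 2 / η ≤ r →
          P.real {ω | r ≤ |IsingModel.differenceBilinear a (X₁ ω) (X₂ ω)
              - ∫ ω', IsingModel.differenceBilinear a (X₁ ω') (X₂ ω') ∂P|}
            ≤ 4 * Real.exp
                (-(η * r / (c' * Fintype.card V * Real.log (Fintype.card V))))) := by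
  refine ⟨⟨1, 100, one_pos, by norm_num, ?_⟩, ⟨1, 100, one_pos, by norm_num, ?_⟩⟩
  · intro V _ _ p η a hn hη ha Ω _ P _ X hX r hr
    have : Nonempty V := Fintype.card_pos_iff.1 (by lia)
    refine (IsingModel.measureReal_centeredBilinear_le hη ha hX r).trans ?_
    exact mul_le_mul_of_nonneg_left (IsingModel.exp_neg_le_exp_neg_log hn hη.1.le (by norm_num)
      (by norm_num) (IsingModel.nonneg_of_threshold_le hη.1.le hr)) (by norm_num)
  · intro V _ _ p η a hn hη ha Ω _ P _ X₁ X₂ h₁ h₂ hind r hr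
    have : Nonempty V := Fintype.card_pos_iff.1 (by lia)
    refine (IsingModel.measureReal_differenceBilinear_le hη ha h₁ h₂ hind r).trans ?_
    exact mul_le_mul_of_nonneg_left (IsingModel.exp_neg_le_exp_neg_log hn hη.1.le (by norm_num)
      le_rfl (IsingModel.nonneg_of_threshold_le hη.1.le hr)) (by norm_num)
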